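/- Let $F$ be a subfield of $\mathbb R$ and let $K\subseteq\mathbb R$ be a non-empty union of finitely many closed intervals (single points, closed half-lines and $\mathbb R$ itself are allowed) whose boundary $\partial K$ is contained in $F$. Let $\mathcal N=\{g_1,\dots,g_s\}\subset F[x]$ be the natural choice of generators of $K$: if $K=\mathbb R$, then $\mathcal N=\{1\}$; otherwise $\mathcal N$ consists of * $x-a$ for $a\in\partial K$ with $(-\infty,a)\cap K=\emptyset$, * $a-x$ for $a\in\partial K$ with $(a,\infty)\cap K=\emptyset$, * $(x-a)(x-b)$ for $a,b\in\partial K$ with $a<b$ and $(a,b)\cap K=\emptyset$. For $e\in\{0,1\}^s$ write $g^e=g_1^{e_1}\cdots g_s^{e_s}$, and let $F_{\ge 0}=\{a\in F: a\ge 0\}$. Let $\mathrm{Pos}(K)$ be the set of all $f\in F[x]$ with $f\ge 0$ on $K$, and let $T_{\mathcal N}=\sum_{e\in\{0,1\}^s}F_{\ge 0}F[x]^2g^e$ be the preordering of $F[x]$ generated by $\mathcal N$, that is, the set of all sums $\sum_e\sigma_e g^e$ in which every $\sigma_e$ is a finite sum of weighted squares $a p^2$ with $a\in F_{\ge 0}$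 and $p\in F[x]$. Then: 1. $\mathrm{Pos}(K)=T_{\mathcal N}$. 2. Every $f\in\mathrm{Pos}(K)$ of degree $n$ can be written as $f=\sum_{e\in\{0,1\}^s}\sigma_e g^e$ with $\deg(\sigma_e g^e)\le n$ for all $e$, where $\sigma_e=\sum_{i=1}^{d_e}a_{e,i}f_{e,i}^2$ with $a_{e,i}\in F_{\ge 0}$, $f_{e,i}\in F[x]$ and $d_e=\max\{1,\,n-\deg(g^e)\}$. (In particular $\sigma_e=0$ whenever $\deg(g^e)>n$.) -/

import Mathlib

open Polynomial

/-- A (nonempty) closed interval of the real line, bounded or not; a single point is allowed. -/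
def IsClosedInterval (J : Set ℝ) : Prop :=
  (∃ a b : ℝ, a ≤ b ∧ J = Set.Icc a b) ∨ (∃ a : ℝ, J = Set.Ici a) ∨
    (∃ a : ℝ, J = Set.Iic a) ∨ J = Set.univ

/-- `K` is a union of finitely many closed intervals. -/
def IsFiniteUnionOfClosedIntervals (K : Set ℝ) : Prop :=
  ∃ J : Set (Set ℝ), J.Finite ∧ (∀ I ∈ J, IsClosedInterval I) ∧ K = ⋃₀ J

/-- `Pos(K)`: the polynomials over `F` that are nonnegative at every point of `K`. -/
def Pos (F : Subfield ℝ) (K : Set ℝ) : Set F[X] :=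
  {f | ∀ x ∈ K, 0 ≤ aeval x f}

/-- The natural choice of generators of `K`. For `K = ℝ` the boundary is empty, so that the
first three clauses produce nothing and the set is `{1}`. -/
def naturalGenerators (F : Subfield ℝ) (K : Set ℝ) : Set F[X] :=
  {g | (∃ a : F, (a : ℝ) ∈ frontier K ∧ Set.Iio (a : ℝ) ∩ K = ∅ ∧ g = X - C a) ∨
    (∃ a : F, (a : ℝ) ∈ frontier K ∧ Set.Ioi (a : ℝ) ∩ K = ∅ ∧ g = C a - X) ∨
    (∃ a b : F, (a : ℝ) ∈ frontier K ∧ (b : ℝ) ∈ frontier K ∧ a < b ∧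
      Set.Ioo (a : ℝ) (b : ℝ) ∩ K = ∅ ∧ g = (X - C a) * (X - C b)) ∨
    (K = Set.univ ∧ g = 1)}

/-- `σ` is a sum of `d` weighted squares `aᵢ fᵢ²` with `aᵢ ∈ F`, `aᵢ ≥ 0` and `fᵢ ∈ F[x]`
(weights may be zero, so this says "at most `d`"). -/
def IsSumOfWeightedSquares {F : Subfield ℝ} (d : ℕ) (σ : F[X]) : Prop :=
  ∃ (a : Fin d → F) (f : Fin d → F[X]), (∀ i, 0 ≤ a i) ∧ σ = ∑ i, C (a i) * f i ^ 2

/-- `g ^ e = g₁ ^ e₁ ⋯ gₛ ^ eₛ`, where `e ∈ {0,1} ^ s` is given as the set of the `i` with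
`eᵢ = 1`. -/
noncomputable def genProd {F : Subfield ℝ} {s : ℕ} (g : Fin s → F[X]) (e : Finset (Fin s)) :
    F[X] :=
  ∏ i ∈ e, g i

/-- The preordering `∑ₑ F_{≥0} F[x]² g ^ e` of `F[x]` generated by `g₁, …, gₛ`: the sums of the
`σₑ g ^ e`, where each `σₑ` is a sum of some number of weighted squares. -/
def preordering {F : Subfield ℝ} {s : ℕ} (g : Fin s → F[X]) : Set F[X] :=
  {f | ∃ σ : Finset (Fin s) → F[X], (∀ e, ∃ d : ℕ, IsSumOfWeightedSquares d (σ e)) ∧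
    f = ∑ e, σ e * genProd g e}

/-- The boundary of a finite union of closed intervals is finite. -/
theorem IsFiniteUnionOfClosedIntervals.finite_frontier {K : Set ℝ}
    (hK : IsFiniteUnionOfClosedIntervals K) : (frontier K).Finite := by
  obtain ⟨J, hJ, hI, rfl⟩ := hK
  induction J, hJ using Set.Finite.induction_on with
  | empty => simp
  | @insert I J _ _ ih =>
    rw [Set.sUnion_insert]
    have h1 : (frontier I).Finite := by
      rcases hI I (Set.mem_insert _ _) with ⟨a, b, hab, rfl⟩ | ⟨a, rfl⟩ | ⟨a, rfl⟩ | rfl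
      · rw [frontier_Icc hab]; exact Set.toFinite _
      · rw [frontier_Ici]; exact Set.toFinite _
      · rw [frontier_Iic]; exact Set.toFinite _
      · simp
    have h2 := ih fun I' h => hI I' (Set.mem_insert_of_mem _ h)
    refine (h1.union h2).subset ((frontier_union_subset _ _).trans ?_)
    exact Set.union_subset_union Set.inter_subset_left Set.inter_subset_right

/-- The natural choice of generators is a finite set, so it can be listed as `g₁, …, gₛ`. -/
theorem naturalGenerators_finite (F : Subfield ℝ) {K : Set ℝ}
    (hK : IsFiniteUnionOfClosedIntervals K) : (naturalGenerators F K).Finite := by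
  have hB : {a : F | (a : ℝ) ∈ frontier K}.Finite :=
    hK.finite_frontier.preimage Subtype.val_injective.injOn
  have h1 := hB.image fun a : F => (X - C a : F[X])
  have h2 := hB.image fun a : F => (C a - X : F[X])
  have h3 := (hB.prod hB).image fun p : F × F => ((X - C p.1) * (X - C p.2) : F[X])
  refine (((h1.union h2).union h3).union (Set.finite_singleton (1 : F[X]))).subset ?_
  rintro g (⟨a, ha, -, rfl⟩ | ⟨a, ha, -, rfl⟩ | ⟨a, b, ha, hb, -, -, rfl⟩ | ⟨-, rfl⟩)
  · exact Or.inl (Or.inl (Or.inl ⟨a, ha, rfl⟩))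
  · exact Or.inl (Or.inl (Or.inr ⟨a, ha, rfl⟩))
  · exact Or.inl (Or.inr ⟨(a, b), ⟨ha, hb⟩, rfl⟩)
  · exact Or.inr rfl

/-!
Over `ℝ`, a polynomial `f` that is nonnegative on `K` is reduced by induction on its degree: if
`f` is negative somewhere in a gap `(a, b)` of `K`, then it has roots `r < s` in `[a, b]` with
`f < 0` between them, the quotient of `f` by `(X - r) * (X - s)` is again nonnegative on `K`, and
`(X - r) * (X - s)` is a nonnegative multiple of `(X - a) * (X - b)` plus a sum of squares
(`quadratic_eq_combination`, `mem_nonnegCone_of_nonneg_on`). In an unbounded gap a single root is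
split off in the same way. No cancellation of leading terms
occurs, which gives the degree bound.

Over the subfield `F` the roots of `f` are not available. As `F` is dense in `ℝ`, there are
`F`-linear retractions `φ : ℝ → F` arbitrarily close to the identity on finitely many numbers
(`exists_seq_linearMap_tendsto`). Applied to the coefficients of a real representation
`f = ∑ σₑ gᵉ`, such a `φ` fixes `f` and the `gᵉ`, and turns `σₑ` into a polynomial over `F`
which need not be a sum of weighted squares, but becomes one after adding a small multiple of
`1 + X² + ⋯ + X²ᵐ` (`eventually_mapCoeff_add_mem_weightedSquares`). It is therefore enough that a
small positive multiple of a suitable polynomial `v`, a sum of such terms, can be subtracted from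
`f` without losing nonnegativity on `K`.

This is possible if every zero of `f` in `K` lies in `F` and is simple or isolated in `K`, since
then `v` can be made to vanish at these zeros, and `f` dominates `v` on `K`
(`exists_abs_eval_le_mul`, `hasBoundedRepresentation_of_simple_zeros`). Any other zero in `K` is a
multiple zero that is not isolated in `K`, and then `f` is divisible by the square of its minimal
polynomial over `F`, with a quotient that is nonnegative on `K`
(`exists_eq_sq_mul_of_multiple_zero`), so that induction on the degree applies.

Finally, a sum of weighted squares of polynomials of degree at most `m` needs only `m + 1` terms
(`isSumOfWeightedSquares_sum`), which is diagonalization of a quadratic form.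
-/

/-! ### The cone generated by a finite family of real polynomials -/

/-- The degree-`n` part of the preordering of `ℝ[X]` generated by the family `G`: the sums of
products `σ * ∏ i ∈ e, G i` of degree at most `n`, where `σ` is nonnegative on `ℝ`. Nonnegativity
of `σ` stands in for `σ` being a sum of squares. -/
noncomputable def nonnegCone {ι : Type*} (G : ι → ℝ[X]) (n : ℕ) : AddSubmonoid ℝ[X] :=
  AddSubmonoid.closure {t | ∃ (σ : ℝ[X]) (e : Finset ι), (∀ x, 0 ≤ σ.eval x) ∧
    (σ * ∏ i ∈ e, G i).natDegree ≤ n ∧ t = σ * ∏ i ∈ e, G i}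

section nonnegCone

variable {ι : Type*} {G : ι → ℝ[X]}

theorem mem_nonnegCone_of_nonneg {n : ℕ} {σ : ℝ[X]} (hσ : ∀ x, 0 ≤ σ.eval x)
    (hn : σ.natDegree ≤ n) : σ ∈ nonnegCone G n :=
  AddSubmonoid.subset_closure ⟨σ, ∅, hσ, by simpa using hn, by simp⟩

theorem generator_mem_nonnegCone {n : ℕ} (i : ι) (hn : (G i).natDegree ≤ n) :
    G i ∈ nonnegCone G n :=
  AddSubmonoid.subset_closure ⟨1, {i}, by simp, by simpa using hn, by simp⟩

theorem mul_mem_nonnegCone {m n : ℕ} {p q : ℝ[X]} (hp : p ∈ nonnegCone G m)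
    (hq : q ∈ nonnegCone G n) : p * q ∈ nonnegCone G (m + n) := by
  classical
  induction hp using AddSubmonoid.closure_induction with
  | zero => simp
  | add x y _ _ hx hy => rw [add_mul]; exact add_mem hx hy
  | mem x hx =>
    induction hq using AddSubmonoid.closure_induction with
    | zero => simp
    | add y z _ _ hy hz => rw [mul_add]; exact add_mem hy hz
    | mem y hy =>
      obtain ⟨σ, e, hσ, hd, rfl⟩ := hx
      obtain ⟨τ, e', hτ, hd', rfl⟩ := hy
      -- the factors common to both products form a square
      have key : (∏ i ∈ e, G i) * ∏ i ∈ e', G i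
          = (∏ i ∈ e ∩ e', G i) ^ 2 * ∏ i ∈ symmDiff e e', G i := by
        have h : symmDiff e e' = (e ∪ e') \ (e ∩ e') := by
          ext i; simp only [Finset.mem_symmDiff, Finset.mem_sdiff, Finset.mem_union,
            Finset.mem_inter]; tauto
        have h2 : e ∩ e' ⊆ e ∪ e' := Finset.inter_subset_left.trans Finset.subset_union_left
        rw [h, ← Finset.prod_union_inter, ← Finset.prod_sdiff h2]
        ring
      have key' : σ * (∏ i ∈ e, G i) * (τ * ∏ i ∈ e', G i)
          = (σ * τ * (∏ i ∈ e ∩ e', G i) ^ 2) * ∏ i ∈ symmDiff e e', G i := by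
        linear_combination σ * τ * key
      refine AddSubmonoid.subset_closure ⟨_, _, fun x => ?_, ?_, key'⟩
      · simp only [eval_mul, eval_pow]
        exact mul_nonneg (mul_nonneg (hσ x) (hτ x)) (sq_nonneg _)
      · rw [← key']
        exact natDegree_mul_le.trans (add_le_add hd hd')

/-- An element of the cone is a sum with one term for each product of generators. -/
theorem exists_sum_of_mem_nonnegCone [Fintype ι] {n : ℕ} {p : ℝ[X]} (hp : p ∈ nonnegCone G n) :
    ∃ σ : Finset ι → ℝ[X], (∀ e x, 0 ≤ (σ e).eval x) ∧
      (∀ e, (σ e * ∏ i ∈ e, G i).natDegree ≤ n) ∧ p = ∑ e, σ e * ∏ i ∈ e, G i := by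
  classical
  induction hp using AddSubmonoid.closure_induction with
  | zero => exact ⟨0, by simp, by simp, by simp⟩
  | add x y _ _ hx hy =>
    obtain ⟨σ, h1, h2, rfl⟩ := hx
    obtain ⟨τ, h3, h4, rfl⟩ := hy
    refine ⟨σ + τ, fun e x => ?_, fun e => ?_, ?_⟩
    · simpa using add_nonneg (h1 e x) (h3 e x)
    · rw [Pi.add_apply, add_mul]
      exact natDegree_add_le_of_degree_le (h2 e) (h4 e)
    · simp [add_mul, Finset.sum_add_distrib]
  | mem x hx =>
    obtain ⟨σ, e, hσ, hd, rfl⟩ := hx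
    refine ⟨Pi.single e σ, fun e' x => ?_, fun e' => ?_, ?_⟩
    · by_cases h : e' = e
      · subst h; simpa using hσ x
      · simp [h]
    · by_cases h : e' = e
      · subst h; simpa using hd
      · simp [h]
    · rw [Finset.sum_eq_single e] <;> simp +contextual

end nonnegCone

/-! ### Nonnegative polynomials on a closed set: the real case -/

theorem exists_last_root {f : ℝ[X]} {a c : ℝ} (hac : a ≤ c) (ha : 0 ≤ f.eval a)
    (hc : f.eval c < 0) : ∃ r, a ≤ r ∧ r < c ∧ f.eval r = 0 ∧ ∀ x, r < x → x ≤ c → f.eval x < 0 := by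
  have hcomp : IsCompact (Set.Icc a c ∩ {x | 0 ≤ f.eval x}) :=
    isCompact_Icc.inter_right (isClosed_le continuous_const f.continuous)
  obtain ⟨r, ⟨⟨har, hrc⟩, hr⟩, hmax⟩ := hcomp.exists_isGreatest ⟨a, ⟨le_rfl, hac⟩, ha⟩
  have hlt : ∀ x, r < x → x ≤ c → f.eval x < 0 := by
    intro x hx hxc
    by_contra! h
    exact absurd (hmax ⟨⟨har.trans hx.le, hxc⟩, h⟩) (not_le.2 hx)
  have hrc' : r < c := lt_of_le_of_ne hrc (by rintro rfl; exact absurd hc (not_lt.2 hr))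
  refine ⟨r, har, hrc', le_antisymm ?_ hr, hlt⟩
  have : Set.Icc r c ⊆ {x | f.eval x ≤ 0} := by
    rw [← closure_Ioo hrc'.ne]
    exact closure_minimal (fun x hx => (hlt x hx.1 hx.2.le).le)
      (isClosed_le f.continuous continuous_const)
  exact this ⟨le_rfl, hrc⟩

theorem exists_first_root {f : ℝ[X]} {b c : ℝ} (hcb : c ≤ b) (hb : 0 ≤ f.eval b)
    (hc : f.eval c < 0) : ∃ r, c < r ∧ r ≤ b ∧ f.eval r = 0 ∧ ∀ x, c ≤ x → x < r → f.eval x < 0 := by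
  obtain ⟨r, h1, h2, h3, h4⟩ := exists_last_root (f := f.comp (-X)) (a := -b) (c := -c)
    (by linarith) (by simpa using hb) (by simpa using hc)
  refine ⟨-r, by linarith, by linarith, by simpa using h3, fun x hx hxr => ?_⟩
  simpa using h4 (-x) (by linarith) (by linarith)

theorem eval_nonneg_on_Icc {h : ℝ[X]} {a b : ℝ} (hab : a < b)
    (H : ∀ x, a < x → x < b → 0 ≤ h.eval x) {x : ℝ} (hx : x ∈ Set.Icc a b) : 0 ≤ h.eval x := by
  have : Set.Icc a b ⊆ {x | 0 ≤ h.eval x} := by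
    rw [← closure_Ioo hab.ne]
    exact closure_minimal (fun x hx => H x hx.1 hx.2)
      (isClosed_le continuous_const h.continuous)
  exact this hx

/-- A quadratic polynomial with roots in `[a, b]` is a nonnegative multiple of `(X - a) * (X - b)`
plus a sum of squares. -/
theorem quadratic_eq_combination {a b r s : ℝ} (har : a ≤ r) (hrs : r < s) (hsb : s ≤ b) :
    ∃ t σ, 0 ≤ t ∧ (∀ x, 0 ≤ eval x σ) ∧ σ.natDegree ≤ 2 ∧
      ((X - C r) * (X - C s) : ℝ[X]) = C t * ((X - C a) * (X - C b)) + σ := by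
  have hsa : 0 < s - a := by linarith
  have hba : 0 < b - a := by linarith
  -- first move `b` to `s`, then `a` to `r`
  have h1 : ((X - C a) * (X - C s) : ℝ[X])
      = C ((s - a) / (b - a)) * ((X - C a) * (X - C b)) + C ((b - s) / (b - a)) * (X - C a) ^ 2 := by
    have e1 : (b - s) / (b - a) = 1 - (s - a) / (b - a) := by field_simp; ring
    have e2 : s = a + (s - a) / (b - a) * (b - a) := by field_simp; ring
    rw [e1]
    generalize (s - a) / (b - a) = t at e2
    rw [e2]
    simp only [C_add, C_mul, C_sub, C_1]
    ring
  have h2 : ((X - C r) * (X - C s) : ℝ[X])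
      = C ((s - r) / (s - a)) * ((X - C a) * (X - C s)) + C ((r - a) / (s - a)) * (X - C s) ^ 2 := by
    have e1 : (r - a) / (s - a) = 1 - (s - r) / (s - a) := by field_simp; ring
    have e2 : r = s - (s - r) / (s - a) * (s - a) := by field_simp; ring
    rw [e1]
    generalize (s - r) / (s - a) = t at e2
    rw [e2]
    simp only [C_mul, C_sub, C_1]
    ring
  refine ⟨(s - r) / (s - a) * ((s - a) / (b - a)), C ((s - r) / (s - a)) * (C ((b - s) / (b - a)) *
    (X - C a) ^ 2) + C ((r - a) / (s - a)) * (X - C s) ^ 2, ?_, fun x => ?_, ?_, ?_⟩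
  · exact mul_nonneg (div_nonneg (by linarith) hsa.le) (div_nonneg hsa.le hba.le)
  · simp only [eval_add, eval_mul, eval_C, eval_pow]
    have := div_nonneg (sub_nonneg.2 hrs.le) hsa.le
    have := div_nonneg (sub_nonneg.2 hsb) hba.le
    have := div_nonneg (sub_nonneg.2 har) hsa.le
    positivity
  · compute_degree
  · rw [h2, h1, C_mul]
    ring

/-- Every real polynomial that is nonnegative on a nonempty closed set `K` lies in the cone, with
the optimal degree bound, as soon as the family contains a generator for each gap of `K`. -/
theorem mem_nonnegCone_of_nonneg_on {ι : Type*} {G : ι → ℝ[X]} {K : Set ℝ} (hK : IsClosed K)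
    (hne : K.Nonempty)
    (hleft : ∀ a ∈ frontier K, Set.Iio a ∩ K = ∅ → X - C a ∈ Set.range G)
    (hright : ∀ a ∈ frontier K, Set.Ioi a ∩ K = ∅ → C a - X ∈ Set.range G)
    (hgap : ∀ a ∈ frontier K, ∀ b ∈ frontier K, a < b → Set.Ioo a b ∩ K = ∅ →
      (X - C a) * (X - C b) ∈ Set.range G)
    (n : ℕ) (f : ℝ[X]) (hn : f.natDegree ≤ n) (hf : ∀ x ∈ K, 0 ≤ f.eval x) :
    f ∈ nonnegCone G n := by
  induction n using Nat.strong_induction_on generalizing f with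
  | _ n ih =>
  by_cases hpos : ∀ x, 0 ≤ f.eval x
  · exact mem_nonnegCone_of_nonneg hpos hn
  push Not at hpos
  obtain ⟨c, hc⟩ := hpos
  have hcK : c ∉ K := fun h => absurd hc (not_lt.2 (hf c h))
  have hf0 : f ≠ 0 := by rintro rfl; simp at hc
  have hfr : ∀ a ∈ K, a ∈ closure Kᶜ → a ∈ frontier K := fun a ha h => by
    rw [frontier_eq_closure_inter_closure]; exact ⟨subset_closure ha, h⟩
  have hdeg : ∀ {r : ℝ} {p q : ℝ[X]}, p ≠ 0 → p = (X - C r) * q →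
      q ≠ 0 ∧ p.natDegree = 1 + q.natDegree := by
    rintro r p q hp rfl
    have hq : q ≠ 0 := right_ne_zero_of_mul hp
    exact ⟨hq, by rw [natDegree_mul (X_sub_C_ne_zero r) hq, natDegree_X_sub_C]⟩
  -- the first point of `K` to the right of `c`
  have hR : (K ∩ Set.Ici c).Nonempty → ∃ b, c < b ∧ b ∈ K ∧ b ∈ frontier K ∧
      ∀ x ∈ K, c ≤ x → b ≤ x := by
    intro h
    have hbdd : BddBelow (K ∩ Set.Ici c) := ⟨c, fun x hx => hx.2⟩
    have hb := (hK.inter isClosed_Ici).csInf_mem h hbdd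
    have hb' : ∀ x ∈ K, c ≤ x → sInf (K ∩ Set.Ici c) ≤ x := fun x hx hcx =>
      csInf_le hbdd ⟨hx, hcx⟩
    have hlt : c < sInf (K ∩ Set.Ici c) :=
      lt_of_le_of_ne hb.2 (by intro h; rw [← h] at hb; exact hcK hb.1)
    refine ⟨_, hlt, hb.1, hfr _ hb.1 ?_, hb'⟩
    have : Set.Icc c (sInf (K ∩ Set.Ici c)) ⊆ closure Kᶜ := by
      rw [← closure_Ioo hlt.ne]
      exact closure_mono fun x hx hxK => absurd (hb' x hxK hx.1.le) (not_le.2 hx.2)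
    exact this ⟨hlt.le, le_rfl⟩
  have hL : (K ∩ Set.Iic c).Nonempty → ∃ a, a < c ∧ a ∈ K ∧ a ∈ frontier K ∧
      ∀ x ∈ K, x ≤ c → x ≤ a := by
    intro h
    have hbdd : BddAbove (K ∩ Set.Iic c) := ⟨c, fun x hx => hx.2⟩
    have hb := (hK.inter isClosed_Iic).csSup_mem h hbdd
    have hb' : ∀ x ∈ K, x ≤ c → x ≤ sSup (K ∩ Set.Iic c) := fun x hx hcx =>
      le_csSup hbdd ⟨hx, hcx⟩
    have hlt : sSup (K ∩ Set.Iic c) < c :=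
      lt_of_le_of_ne hb.2 (by intro h; rw [h] at hb; exact hcK hb.1)
    refine ⟨_, hlt, hb.1, hfr _ hb.1 ?_, hb'⟩
    have : Set.Icc (sSup (K ∩ Set.Iic c)) c ⊆ closure Kᶜ := by
      rw [← closure_Ioo hlt.ne]
      exact closure_mono fun x hx hxK => absurd (hb' x hxK hx.2.le) (not_le.2 hx.1)
    exact this ⟨le_rfl, hlt.le⟩
  by_cases hl : (K ∩ Set.Iic c).Nonempty
  · obtain ⟨a, hac, haK, hafr, ha⟩ := hL hl
    obtain ⟨r, har, hrc, hr0, hrneg⟩ := exists_last_root hac.le (hf a haK) hc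
    obtain ⟨q, hq⟩ := dvd_iff_isRoot.2 hr0
    obtain ⟨hq0, hdq⟩ := hdeg hf0 hq
    by_cases hr : (K ∩ Set.Ici c).Nonempty
    · obtain ⟨b, hcb, hbK, hbfr, hb⟩ := hR hr
      obtain ⟨s, hcs, hsb, hs0, hsneg⟩ := exists_first_root hcb.le (hf b hbK) hc
      have hqs : q.eval s = 0 := by
        rw [hq] at hs0
        simpa [sub_ne_zero.2 (hrc.trans hcs).ne'] using hs0
      obtain ⟨h, hh⟩ := dvd_iff_isRoot.2 hqs
      obtain ⟨hh0, hdh⟩ := hdeg hq0 hh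
      have hfac : f = (X - C r) * (X - C s) * h := by rw [hq, hh, mul_assoc]
      have hev : ∀ x, f.eval x = (x - r) * (x - s) * h.eval x := fun x => by simp [hfac]
      have hin : ∀ x ∈ Set.Icc r s, 0 ≤ h.eval x := fun x hx => by
        refine eval_nonneg_on_Icc (hrc.trans hcs) (fun y hy1 hy2 => ?_) hx
        have h1 : f.eval y < 0 := by
          rcases le_total y c with h | h
          · exact hrneg y hy1 h
          · exact hsneg y h hy2
        rw [hev] at h1
        have h2 : (y - r) * (y - s) < 0 := mul_neg_of_pos_of_neg (by linarith) (by linarith)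
        by_contra! h3
        nlinarith
      have hhK : ∀ x ∈ K, 0 ≤ h.eval x := by
        intro x hx
        have h1 := hf x hx
        rw [hev] at h1
        by_cases hxrs : x ∈ Set.Icc r s
        · exact hin x hxrs
        · refine nonneg_of_mul_nonneg_right h1 ?_
          rcases lt_or_ge x r with h | h
          · exact mul_pos_of_neg_of_neg (by linarith) (by linarith)
          · have : s < x := by by_contra! h'; exact hxrs ⟨h, h'⟩
            exact mul_pos (by linarith) (by linarith)
      have hgab : (X - C a) * (X - C b) ∈ Set.range G := by
        refine hgap a hafr b hbfr (hac.trans hcb) (Set.eq_empty_iff_forall_notMem.2 ?_)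
        rintro x ⟨hx, hxK⟩
        rcases le_total x c with h | h
        · exact absurd (ha x hxK h) (not_le.2 hx.1)
        · exact absurd (hb x hxK h) (not_le.2 hx.2)
      obtain ⟨i, hi⟩ := hgab
      obtain ⟨t, σ, ht, hσ, hdσ, hts⟩ := quadratic_eq_combination har (hrc.trans hcs) hsb
      have hquad : (X - C r) * (X - C s) ∈ nonnegCone G 2 := by
        rw [hts, ← hi]
        refine add_mem ?_ (mem_nonnegCone_of_nonneg hσ hdσ)
        have h1 : (C t : ℝ[X]) ∈ nonnegCone G 0 :=
          mem_nonnegCone_of_nonneg (by simpa using ht) (by simp)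
        have h2 : G i ∈ nonnegCone G 2 := generator_mem_nonnegCone i (by
          rw [hi]; compute_degree)
        simpa using mul_mem_nonnegCone h1 h2
      have := mul_mem_nonnegCone hquad (ih (n - 2) (by omega) h (by omega) hhK)
      rwa [← hfac, show 2 + (n - 2) = n by omega] at this
    · have hxa : ∀ x ∈ K, x ≤ a := fun x hx => ha x hx (by
        by_contra! h; exact hr ⟨x, hx, h.le⟩)
      have hqK : ∀ x ∈ K, 0 ≤ (-q).eval x := by
        intro x hx
        have hin : ∀ x ∈ Set.Icc r c, 0 ≤ (-q).eval x := fun x hx => by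
          refine eval_nonneg_on_Icc hrc (fun y hy1 hy2 => ?_) hx
          have h1 := hrneg y hy1 hy2.le
          rw [hq, eval_mul, eval_sub, eval_X, eval_C] at h1
          rw [eval_neg]
          by_contra! h3
          nlinarith
        rcases eq_or_lt_of_le ((hxa x hx).trans har) with h | h
        · exact hin x ⟨h.ge, h ▸ hrc.le⟩
        · have h1 := hf x hx
          rw [hq, eval_mul, eval_sub, eval_X, eval_C] at h1
          rw [eval_neg]
          by_contra! h3
          nlinarith
      obtain ⟨i, hi⟩ := hright a hafr (Set.eq_empty_iff_forall_notMem.2 fun x hx =>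
        absurd (hxa x hx.2) (not_le.2 hx.1))
      have hlin : C r - X ∈ nonnegCone G 1 := by
        have : (C r - X : ℝ[X]) = G i + C (r - a) := by rw [hi, C_sub]; ring
        rw [this]
        refine add_mem (generator_mem_nonnegCone i (by rw [hi]; compute_degree))
          (mem_nonnegCone_of_nonneg (by simpa using har) (by simp))
      have := mul_mem_nonnegCone hlin (ih (n - 1) (by omega) (-q) (by rw [natDegree_neg]; omega) hqK)
      rwa [show (C r - X) * -q = f by rw [hq]; ring, show 1 + (n - 1) = n by omega] at this
  · have hr : (K ∩ Set.Ici c).Nonempty := by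
      obtain ⟨x, hx⟩ := hne
      rcases le_total x c with h | h
      · exact absurd ⟨x, hx, h⟩ hl
      · exact ⟨x, hx, h⟩
    obtain ⟨b, hcb, hbK, hbfr, hb⟩ := hR hr
    obtain ⟨s, hcs, hsb, hs0, hsneg⟩ := exists_first_root hcb.le (hf b hbK) hc
    obtain ⟨q, hq⟩ := dvd_iff_isRoot.2 hs0
    obtain ⟨hq0, hdq⟩ := hdeg hf0 hq
    have hxb : ∀ x ∈ K, b ≤ x := fun x hx => hb x hx (by
      by_contra! h; exact hl ⟨x, hx, h.le⟩)
    have hqK : ∀ x ∈ K, 0 ≤ q.eval x := by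
      intro x hx
      have hin : ∀ x ∈ Set.Icc c s, 0 ≤ q.eval x := fun x hx => by
        refine eval_nonneg_on_Icc hcs (fun y hy1 hy2 => ?_) hx
        have h1 := hsneg y hy1.le hy2
        rw [hq, eval_mul, eval_sub, eval_X, eval_C] at h1
        by_contra! h3
        nlinarith
      rcases eq_or_lt_of_le (hsb.trans (hxb x hx)) with h | h
      · exact hin x ⟨h ▸ hcs.le, h.ge⟩
      · have h1 := hf x hx
        rw [hq, eval_mul, eval_sub, eval_X, eval_C] at h1
        by_contra! h3
        nlinarith
    obtain ⟨i, hi⟩ := hleft b hbfr (Set.eq_empty_iff_forall_notMem.2 fun x hx =>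
      absurd (hxb x hx.2) (not_le.2 hx.1))
    have hlin : X - C s ∈ nonnegCone G 1 := by
      have : (X - C s : ℝ[X]) = G i + C (b - s) := by rw [hi, C_sub]; ring
      rw [this]
      refine add_mem (generator_mem_nonnegCone i (by rw [hi]; compute_degree))
        (mem_nonnegCone_of_nonneg (by simpa using hsb) (by simp))
    have := mul_mem_nonnegCone hlin (ih (n - 1) (by omega) q (by omega) hqK)
    rwa [← hq, show 1 + (n - 1) = n by omega] at this

/-! ### Globally nonnegative real polynomials -/

theorem exists_eq_sq_mul_of_nonneg {σ : ℝ[X]} (hσ : ∀ x, 0 ≤ σ.eval x) {c : ℝ}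
    (hc : σ.eval c = 0) : ∃ τ : ℝ[X], (∀ x, 0 ≤ τ.eval x) ∧ σ = (X - C c) ^ 2 * τ := by
  obtain ⟨q, hq⟩ := dvd_iff_isRoot.2 hc
  have hev : ∀ x, 0 ≤ (x - c) * q.eval x := fun x => by simpa [hq] using hσ x
  have h1 : 0 ≤ q.eval c := eval_nonneg_on_Icc (a := c) (b := c + 1) (by linarith)
    (fun x hx _ => nonneg_of_mul_nonneg_right (hev x) (by linarith)) ⟨le_rfl, by linarith⟩
  have h2 : 0 ≤ (-q).eval c := eval_nonneg_on_Icc (a := c - 1) (b := c) (by linarith)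
    (fun x _ hx => by
      rw [eval_neg]
      have := hev x
      by_contra! h
      nlinarith) ⟨by linarith, le_rfl⟩
  rw [eval_neg] at h2
  obtain ⟨τ, hτ⟩ := dvd_iff_isRoot.2 (show q.eval c = 0 by linarith)
  have hτe : ∀ x, x ≠ c → 0 ≤ τ.eval x := fun x hx => by
    have h3 := hev x
    rw [hτ] at h3
    have h4 : 0 ≤ (x - c) ^ 2 * τ.eval x := by simpa [sq, mul_assoc] using h3
    exact nonneg_of_mul_nonneg_right h4 (by have := sub_ne_zero.2 hx; positivity)
  refine ⟨τ, fun x => ?_, by rw [hq, hτ]; ring⟩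
  by_cases hx : x = c
  · exact eval_nonneg_on_Icc (a := c) (b := c + 1) (by linarith)
      (fun y hy _ => hτe y hy.ne') ⟨hx.ge, by linarith⟩
  · exact hτe x hx

theorem exists_eq_prod_sq_mul_of_nonneg {σ : ℝ[X]} (hσ : ∀ x, 0 ≤ σ.eval x) {S : Finset ℝ}
    (hS : ∀ c ∈ S, σ.eval c = 0) :
    ∃ τ : ℝ[X], (∀ x, 0 ≤ τ.eval x) ∧ σ = (∏ c ∈ S, (X - C c)) ^ 2 * τ := by
  induction S using Finset.induction_on with
  | empty => exact ⟨σ, hσ, by simp⟩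
  | insert c S hcS ih =>
    obtain ⟨τ, hτ, h⟩ := ih fun x hx => hS x (Finset.mem_insert_of_mem hx)
    have hc : τ.eval c = 0 := by
      have h1 := hS c (Finset.mem_insert_self c S)
      rw [h, eval_mul, eval_pow, eval_prod] at h1
      refine (mul_eq_zero.1 h1).resolve_left (pow_ne_zero _ (Finset.prod_ne_zero_iff.2 ?_))
      intro d hd
      rw [eval_sub, eval_X, eval_C, sub_ne_zero]
      rintro rfl
      exact hcS hd
    obtain ⟨ρ, hρ, h'⟩ := exists_eq_sq_mul_of_nonneg hτ hc
    exact ⟨ρ, hρ, by rw [h, h', Finset.prod_insert hcS]; ring⟩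

/-! ### Sums of weighted squares of bounded degree -/

/-- The sums of weighted squares `a * p ^ 2` with `0 ≤ a` in the ordered field `k` and
`p ∈ k[X]` of degree at most `m`. -/
noncomputable def weightedSquares (k : Type*) [Field k] [LinearOrder k] (m : ℕ) :
    AddSubmonoid k[X] :=
  AddSubmonoid.closure {t | ∃ (a : k) (p : k[X]), 0 ≤ a ∧ p.natDegree ≤ m ∧ t = C a * p ^ 2}

section weightedSquares

variable {k : Type*} [Field k]

variable (k) in
/-- `1 + X² + ⋯ + X²ᵐ`, an order unit for the cone of sums of weighted squares in the space of
polynomials of degree at most `2m`. -/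
noncomputable def evenPowerSum (m : ℕ) : k[X] := ∑ j ∈ Finset.range (m + 1), X ^ (2 * j)

theorem natDegree_evenPowerSum_le (m : ℕ) : (evenPowerSum k m).natDegree ≤ 2 * m := by
  refine natDegree_sum_le_of_forall_le _ _ fun j hj => ?_
  rw [Finset.mem_range] at hj
  exact (natDegree_X_pow_le _).trans (by omega)

variable [LinearOrder k]

theorem C_mul_sq_mem_weightedSquares {m : ℕ} {a : k} {p : k[X]} (ha : 0 ≤ a)
    (hp : p.natDegree ≤ m) : C a * p ^ 2 ∈ weightedSquares k m :=
  AddSubmonoid.subset_closure ⟨a, p, ha, hp, rfl⟩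

theorem sq_mul_mem_weightedSquares {l m : ℕ} {p q : k[X]} (hp : p.natDegree ≤ l)
    (hq : q ∈ weightedSquares k m) : p ^ 2 * q ∈ weightedSquares k (l + m) := by
  induction hq using AddSubmonoid.closure_induction with
  | zero => simp
  | add x y _ _ hx hy => rw [mul_add]; exact add_mem hx hy
  | mem x hx =>
    obtain ⟨a, r, ha, hr, rfl⟩ := hx
    rw [show p ^ 2 * (C a * r ^ 2) = C a * (p * r) ^ 2 by ring]
    exact C_mul_sq_mem_weightedSquares ha (natDegree_mul_le.trans (add_le_add hp hr))

theorem natDegree_le_of_mem_weightedSquares {m : ℕ} {p : k[X]} (hp : p ∈ weightedSquares k m) :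
    p.natDegree ≤ 2 * m := by
  induction hp using AddSubmonoid.closure_induction with
  | zero => simp
  | add x y _ _ hx hy => exact natDegree_add_le_of_degree_le hx hy
  | mem x hx =>
    obtain ⟨a, r, ha, hr, rfl⟩ := hx
    exact (natDegree_C_mul_le _ _).trans (natDegree_pow_le.trans (by omega))

theorem C_mul_sum_X_pow_mem_weightedSquares {m : ℕ} {a : k} (ha : 0 ≤ a) {T : Finset ℕ}
    (hT : T ⊆ Finset.range (m + 1)) : C a * ∑ j ∈ T, X ^ (2 * j) ∈ weightedSquares k m := by
  rw [Finset.mul_sum]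
  refine sum_mem fun j hj => ?_
  have := Finset.mem_range.1 (hT hj)
  rw [mul_comm 2 j, pow_mul]
  exact C_mul_sq_mem_weightedSquares ha ((natDegree_X_pow_le _).trans (by omega))

variable [IsStrictOrderedRing k]

theorem evenPowerSum_add_monomial_mem_weightedSquares {m i : ℕ} (hi : i ≤ 2 * m) (c : k) :
    C |c| * evenPowerSum k m + monomial i c ∈ weightedSquares k m := by
  rw [evenPowerSum, ← C_mul_X_pow_eq_monomial]
  obtain ⟨j, rfl | rfl⟩ := Nat.even_or_odd' i
  · have hT : {j} ⊆ Finset.range (m + 1) := by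
      rw [Finset.singleton_subset_iff, Finset.mem_range]; omega
    rw [← Finset.sum_sdiff hT, mul_add, add_assoc]
    refine add_mem (C_mul_sum_X_pow_mem_weightedSquares (abs_nonneg c) Finset.sdiff_subset) ?_
    rw [Finset.sum_singleton, ← add_mul, ← C_add, mul_comm 2 j, pow_mul]
    exact C_mul_sq_mem_weightedSquares (by linarith [neg_abs_le c])
      ((natDegree_X_pow_le _).trans (by omega))
  · have hT : {j, j + 1} ⊆ Finset.range (m + 1) := by
      intro x
      rw [Finset.mem_insert, Finset.mem_singleton, Finset.mem_range]
      omega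
    rw [← Finset.sum_sdiff hT, mul_add, add_assoc]
    refine add_mem (C_mul_sum_X_pow_mem_weightedSquares (abs_nonneg c) Finset.sdiff_subset) ?_
    rw [Finset.sum_pair (by omega)]
    -- `X ^ (2 * j + 1)` is, up to sign, half a square minus half of the neighbouring even powers
    have h1 : ∀ s : k, s ^ 2 = 1 → |c| * s = c → C |c| * (X ^ (2 * j) + X ^ (2 * (j + 1)))
        + C c * X ^ (2 * j + 1) = C (|c| / 2) * (X ^ j) ^ 2 + C (|c| / 2) * (X ^ (j + 1)) ^ 2
          + C (|c| / 2) * (X ^ j + C s * X ^ (j + 1)) ^ 2 := by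
      intro s hs hc
      have e1 : (C |c| : k[X]) = 2 * C (|c| / 2) := by
        rw [← C_ofNat, ← C_mul]; congr 1; ring
      have e2 : (C c : k[X]) = 2 * C (|c| / 2) * C s := by
        rw [← e1, ← C_mul, hc]
      have e3 : (C s ^ 2 : k[X]) = 1 := by rw [← C_pow, hs, C_1]
      rw [e1, e2]
      linear_combination -(C (|c| / 2) * X ^ (2 * (j + 1))) * e3
    obtain ⟨s, hs, hc⟩ : ∃ s : k, s ^ 2 = 1 ∧ |c| * s = c := by
      rcases abs_cases c with ⟨h, -⟩ | ⟨h, -⟩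
      · exact ⟨1, by ring, by rw [h]; ring⟩
      · exact ⟨-1, by ring, by rw [h]; ring⟩
    rw [h1 s hs hc]
    have hj : ∀ l ≤ j + 1, (X ^ l : k[X]).natDegree ≤ m := fun l hl =>
      (natDegree_X_pow_le _).trans (by omega)
    have hc2 : 0 ≤ |c| / 2 := by positivity
    refine add_mem (add_mem (C_mul_sq_mem_weightedSquares hc2 (hj _ (by omega)))
      (C_mul_sq_mem_weightedSquares hc2 (hj _ (by omega)))) (C_mul_sq_mem_weightedSquares hc2 ?_)
    exact natDegree_add_le_of_degree_le (hj _ (by omega))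
      ((natDegree_C_mul_le _ _).trans (hj _ le_rfl))

theorem evenPowerSum_add_mem_weightedSquares {m : ℕ} {r : k[X]} {ε : k}
    (hr : r.natDegree ≤ 2 * m) (hε : ∑ i ∈ Finset.range (2 * m + 1), |r.coeff i| ≤ ε) :
    C ε * evenPowerSum k m + r ∈ weightedSquares k m := by
  have h1 : r = ∑ i ∈ Finset.range (2 * m + 1), monomial i (r.coeff i) :=
    r.as_sum_range' _ (by omega)
  have h2 : C ε * evenPowerSum k m + r
      = C (ε - ∑ i ∈ Finset.range (2 * m + 1), |r.coeff i|) * evenPowerSum k m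
        + ∑ i ∈ Finset.range (2 * m + 1),
          (C |r.coeff i| * evenPowerSum k m + monomial i (r.coeff i)) := by
    rw [Finset.sum_add_distrib, ← h1, ← Finset.sum_mul, C_sub, map_sum]
    ring
  rw [h2]
  refine add_mem (C_mul_sum_X_pow_mem_weightedSquares (sub_nonneg.2 hε) subset_rfl)
    (sum_mem fun i hi => evenPowerSum_add_monomial_mem_weightedSquares ?_ _)
  rw [Finset.mem_range] at hi
  omega

end weightedSquares

/-- Subtracting its minimum from a nonnegative polynomial and dividing by the square of a linear
factor at a minimizer shows that it is a sum of squares. -/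
theorem mem_weightedSquares_of_nonneg (m : ℕ) (σ : ℝ[X]) (hd : σ.natDegree ≤ 2 * m + 1)
    (hσ : ∀ x, 0 ≤ σ.eval x) : σ ∈ weightedSquares ℝ m := by
  induction m using Nat.strong_induction_on generalizing σ with
  | _ m ih =>
  rcases Nat.eq_zero_or_pos σ.natDegree with h0 | hpos
  · rw [eq_C_of_natDegree_eq_zero h0] at hσ ⊢
    have := C_mul_sq_mem_weightedSquares (m := m) (a := σ.coeff 0) (p := 1) (by simpa using hσ 0)
      (by simp)
    simpa using this
  · have htend : Filter.Tendsto (fun x => σ.eval x) (Filter.cocompact ℝ) Filter.atTop := by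
      have := σ.tendsto_norm_atTop (natDegree_pos_iff_degree_pos.1 hpos)
        (tendsto_norm_cocompact_atTop (E := ℝ))
      refine this.congr fun x => ?_
      rw [Real.norm_eq_abs, abs_of_nonneg (hσ x)]
    obtain ⟨c, hc⟩ := σ.continuous.exists_forall_le htend
    obtain ⟨τ, hτ, h⟩ := exists_eq_sq_mul_of_nonneg (σ := σ - C (σ.eval c)) (c := c)
      (fun x => by simpa using hc x) (by simp)
    have hdeg : σ.natDegree = 2 + τ.natDegree := by
      have h1 : (σ - C (σ.eval c)).natDegree = σ.natDegree := natDegree_sub_C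
      have hτ0 : τ ≠ 0 := by
        rintro rfl
        rw [h, mul_zero, natDegree_zero] at h1
        omega
      rw [← h1, h, natDegree_mul (pow_ne_zero _ (X_sub_C_ne_zero c)) hτ0, natDegree_pow,
        natDegree_X_sub_C]
    have hm : 1 ≤ m := by omega
    have h2 : σ = C (σ.eval c) * 1 ^ 2 + (X - C c) ^ 2 * τ := by rw [← h]; simp
    rw [h2]
    refine add_mem (C_mul_sq_mem_weightedSquares (hσ c) (by simp)) ?_
    have := sq_mul_mem_weightedSquares (natDegree_X_sub_C c).le
      (ih (m - 1) (by omega) τ (by omega) hτ)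
    rwa [show 1 + (m - 1) = m by omega] at this

/-! ### Approximation by polynomials over a subfield -/

/-- The polynomial over `F` obtained from `p` by applying the `F`-linear map `φ` to each
coefficient. It is additive and `F[X]`-linear in `p`. -/
noncomputable def mapCoeff {F : Subfield ℝ} (φ : ℝ →ₗ[F] F) (p : ℝ[X]) : F[X] :=
  ∑ i ∈ Finset.range (p.natDegree + 1), monomial i (φ (p.coeff i))

section mapCoeff

variable {F : Subfield ℝ}

@[simp]
theorem coeff_mapCoeff (φ : ℝ →ₗ[F] F) (p : ℝ[X]) (i : ℕ) :
    (mapCoeff φ p).coeff i = φ (p.coeff i) := by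
  rw [mapCoeff, finsetSum_coeff]
  simp only [coeff_monomial, Finset.sum_ite_eq', Finset.mem_range]
  split_ifs with h
  · rfl
  · rw [coeff_eq_zero_of_natDegree_lt (by omega), map_zero]

theorem mapCoeff_zero (φ : ℝ →ₗ[F] F) : mapCoeff φ 0 = 0 := by ext; simp

theorem mapCoeff_add (φ : ℝ →ₗ[F] F) (p q : ℝ[X]) :
    mapCoeff φ (p + q) = mapCoeff φ p + mapCoeff φ q := by ext; simp

theorem mapCoeff_sum (φ : ℝ →ₗ[F] F) {ι : Type*} (s : Finset ι) (p : ι → ℝ[X]) :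
    mapCoeff φ (∑ i ∈ s, p i) = ∑ i ∈ s, mapCoeff φ (p i) := by
  ext j
  simp

theorem mapCoeff_mul_map (φ : ℝ →ₗ[F] F) (p : ℝ[X]) (q : F[X]) :
    mapCoeff φ (p * q.map (algebraMap F ℝ)) = mapCoeff φ p * q := by
  ext n
  simp only [coeff_mapCoeff, coeff_mul, map_sum, coeff_map]
  congr 1
  refine Finset.sum_congr rfl fun x _ => ?_
  rw [mul_comm, ← Algebra.smul_def, map_smul, smul_eq_mul, mul_comm]

theorem mapCoeff_map {φ : ℝ →ₗ[F] F} (hφ : φ 1 = 1) (q : F[X]) :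
    mapCoeff φ (q.map (algebraMap F ℝ)) = q := by
  ext i
  rw [coeff_mapCoeff, coeff_map, Algebra.algebraMap_eq_smul_one, map_smul, hφ, smul_eq_mul,
    mul_one]

theorem natDegree_mapCoeff_le (φ : ℝ →ₗ[F] F) {p : ℝ[X]} {n : ℕ} (hp : p.natDegree ≤ n) :
    (mapCoeff φ p).natDegree ≤ n := by
  rw [natDegree_le_iff_coeff_eq_zero]
  intro i hi
  rw [coeff_mapCoeff, coeff_eq_zero_of_natDegree_lt (by omega), map_zero]

end mapCoeff

/-- As `F` is dense in `ℝ`, the identity of `ℝ` is a pointwise limit of `F`-linear retractions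
`ℝ → F`: on an `F`-basis of `ℝ` that contains `1`, take approximations in `F` of the other basis
elements. -/
theorem exists_seq_linearMap_tendsto (F : Subfield ℝ) :
    ∃ φ : ℕ → ℝ →ₗ[F] F, (∀ N, φ N 1 = 1) ∧
      ∀ x, Filter.Tendsto (fun N => ((φ N x : F) : ℝ)) Filter.atTop (nhds x) := by
  classical
  have hli : LinearIndepOn F id ({1} : Set ℝ) := LinearIndepOn.singleton one_ne_zero
  let b := Module.Basis.extend hli
  have h1mem : (1 : ℝ) ∈ hli.extend (Set.subset_univ _) :=
    Module.Basis.subset_extend hli (Set.mem_singleton _)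
  have happ : ∀ (x : ℝ) (N : ℕ), ∃ y : F, |(y : ℝ) - x| < 1 / ((N : ℝ) + 1) := fun x N => by
    have hN : (0 : ℝ) < 1 / ((N : ℝ) + 1) := by positivity
    obtain ⟨q, hq1, hq2⟩ := exists_rat_btwn (sub_lt_self x hN)
    refine ⟨q, ?_⟩
    have : (((q : F)) : ℝ) = q := by simp
    rw [this, abs_lt]
    constructor <;> linarith
  choose y hy using happ
  have hytend : ∀ x, Filter.Tendsto (fun N => ((y x N : F) : ℝ)) Filter.atTop (nhds x) := fun x => by
    rw [tendsto_iff_norm_sub_tendsto_zero]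
    exact squeeze_zero (fun _ => norm_nonneg _) (fun N => (hy x N).le)
      tendsto_one_div_add_atTop_nhds_zero_nat
  let v : ℕ → hli.extend (Set.subset_univ _) → F := fun N i => if (i : ℝ) = 1 then 1 else y i N
  have hv : ∀ i, Filter.Tendsto (fun N => ((v N i : F) : ℝ)) Filter.atTop (nhds (i : ℝ)) := by
    intro i
    by_cases h : (i : ℝ) = 1
    · simp [v, h]
    · simpa [v, h] using hytend i
  refine ⟨fun N => b.constr F (v N), fun N => ?_, fun x => ?_⟩
  · have hb1 : b ⟨1, h1mem⟩ = 1 := Module.Basis.extend_apply_self hli _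
    have := b.constr_basis F (v N) ⟨1, h1mem⟩
    rw [hb1] at this
    rw [this]
    simp [v]
  · have hx : x = ∑ i ∈ (b.repr x).support, ((b.repr x i : F) : ℝ) * i := by
      conv_lhs => rw [← b.linearCombination_repr x, Finsupp.linearCombination_apply, Finsupp.sum]
      refine Finset.sum_congr rfl fun i _ => ?_
      rw [Module.Basis.extend_apply_self hli, Algebra.smul_def]; rfl
    have hφ : ∀ N, ((b.constr F (v N) x : F) : ℝ)
        = ∑ i ∈ (b.repr x).support, ((b.repr x i : F) : ℝ) * (v N i : F) := fun N => by
      rw [Module.Basis.constr_apply, Finsupp.sum]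
      push_cast
      rfl
    simp only [hφ]
    conv => enter [3]; rw [hx]
    exact tendsto_finsetSum _ fun i _ => (hv i).const_mul _

/-- Approximating the coefficients of a nonnegative real polynomial by elements of `F` gives a sum
of weighted squares over `F`, up to an arbitrarily small multiple of the order unit. -/
theorem eventually_mapCoeff_add_mem_weightedSquares {F : Subfield ℝ} {φ : ℕ → ℝ →ₗ[F] F}
    (hφ : ∀ x, Filter.Tendsto (fun N => ((φ N x : F) : ℝ)) Filter.atTop (nhds x)) {m : ℕ}
    {σ : ℝ[X]} (hσ : σ ∈ weightedSquares ℝ m) {ε : F} (hε : 0 < ε) :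
    ∀ᶠ N in Filter.atTop, mapCoeff (φ N) σ + C ε * evenPowerSum F m ∈ weightedSquares F m := by
  induction hσ using AddSubmonoid.closure_induction generalizing ε with
  | zero =>
    refine Filter.Eventually.of_forall fun N => ?_
    rw [mapCoeff_zero, zero_add]
    exact C_mul_sum_X_pow_mem_weightedSquares hε.le subset_rfl
  | add x y _ _ hx hy =>
    filter_upwards [hx (half_pos hε), hy (half_pos hε)] with N h1 h2
    have := add_mem h1 h2
    have e : (C ε : F[X]) = C (ε / 2) + C (ε / 2) := by rw [← C_add, add_halves]
    rw [mapCoeff_add, e]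
    convert this using 1
    ring
  | mem x hx =>
    obtain ⟨a, q, ha, hq, rfl⟩ := hx
    obtain ⟨p, hp, hpq⟩ : ∃ p : ℝ[X], p.natDegree ≤ m ∧ C a * q ^ 2 = p * p :=
      ⟨C √a * q, (natDegree_C_mul_le _ _).trans hq, by
        rw [show C √a * q * (C √a * q) = (C √a * C √a) * q ^ 2 by ring, ← C_mul,
          Real.mul_self_sqrt ha]⟩
    rw [hpq]
    let r : ℕ → F[X] := fun N => mapCoeff (φ N) (p * p) - mapCoeff (φ N) p * mapCoeff (φ N) p
    have hr : ∀ N, (r N).natDegree ≤ 2 * m := fun N => by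
      have h1 := natDegree_mapCoeff_le (φ N) hp
      have h2 : (p * p).natDegree ≤ 2 * m := natDegree_mul_le.trans (by omega)
      have h3 : (mapCoeff (φ N) p * mapCoeff (φ N) p).natDegree ≤ 2 * m :=
        natDegree_mul_le.trans (by omega)
      exact (natDegree_sub_le_of_le (natDegree_mapCoeff_le _ h2) h3).trans (max_self _).le
    have hcoeff : ∀ i, Filter.Tendsto (fun N => (((r N).coeff i : F) : ℝ)) Filter.atTop (nhds 0) := by
      intro i
      have h1 : Filter.Tendsto (fun N => ((φ N ((p * p).coeff i) : F) : ℝ)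
          - ∑ x ∈ Finset.HasAntidiagonal.antidiagonal i,
            ((φ N (p.coeff x.1) : F) : ℝ) * (φ N (p.coeff x.2) : F))
          Filter.atTop (nhds ((p * p).coeff i
            - ∑ x ∈ Finset.HasAntidiagonal.antidiagonal i, p.coeff x.1 * p.coeff x.2)) :=
        (hφ _).sub (tendsto_finsetSum _ fun x _ => (hφ _).mul (hφ _))
      rw [← coeff_mul, sub_self] at h1
      refine h1.congr fun N => ?_
      simp [r, coeff_mul]
    have hsum : Filter.Tendsto (fun N => ∑ i ∈ Finset.range (2 * m + 1), |(((r N).coeff i : F) : ℝ)|)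
        Filter.atTop (nhds 0) := by
      have := tendsto_finsetSum (Finset.range (2 * m + 1)) fun i _ => (hcoeff i).abs
      simpa using this
    filter_upwards [hsum.eventually (gt_mem_nhds (show (0 : ℝ) < ε from hε))] with N hN
    have h1 : ∑ i ∈ Finset.range (2 * m + 1), |(r N).coeff i| ≤ ε := by
      have : ((∑ i ∈ Finset.range (2 * m + 1), |(r N).coeff i| : F) : ℝ) < ε := by
        push_cast; exact hN
      exact le_of_lt this
    have h2 := add_mem (evenPowerSum_add_mem_weightedSquares (hr N) h1)
      (C_mul_sq_mem_weightedSquares (zero_le_one (α := F)) (natDegree_mapCoeff_le (φ N) hp))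
    convert h2 using 1
    simp only [r, C_1]
    ring

/-! ### Counting weighted squares -/

section IsSumOfWeightedSquares

variable {F : Subfield ℝ}

theorem isSumOfWeightedSquares_zero (d : ℕ) : IsSumOfWeightedSquares d (0 : F[X]) :=
  ⟨0, 0, by simp, by simp⟩

theorem IsSumOfWeightedSquares.add {d d' : ℕ} {σ τ : F[X]} (hσ : IsSumOfWeightedSquares d σ)
    (hτ : IsSumOfWeightedSquares d' τ) : IsSumOfWeightedSquares (d + d') (σ + τ) := by
  obtain ⟨a, f, ha, rfl⟩ := hσ
  obtain ⟨b, g, hb, rfl⟩ := hτ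
  refine ⟨Fin.append a b, Fin.append f g, fun i => ?_, ?_⟩
  · refine Fin.addCases (fun i => ?_) (fun i => ?_) i
    · simpa using ha i
    · simpa using hb i
  · simp [Fin.sum_univ_add]

theorem IsSumOfWeightedSquares.mono {d d' : ℕ} {σ : F[X]} (hσ : IsSumOfWeightedSquares d σ)
    (h : d ≤ d') : IsSumOfWeightedSquares d' σ := by
  obtain ⟨c, rfl⟩ := Nat.exists_eq_add_of_le h
  simpa using hσ.add (isSumOfWeightedSquares_zero c)

theorem isSumOfWeightedSquares_one {a : F} (ha : 0 ≤ a) (p : F[X]) :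
    IsSumOfWeightedSquares 1 (C a * p ^ 2) :=
  ⟨fun _ => a, fun _ => p, fun _ => ha, by simp⟩

theorem natDegree_le_of_coeff_succ_eq_zero {R : Type*} [Semiring R] {p : R[X]} {m : ℕ}
    (hp : p.natDegree ≤ m + 1) (h : p.coeff (m + 1) = 0) : p.natDegree ≤ m := by
  rw [natDegree_le_iff_coeff_eq_zero]
  intro i hi
  rcases eq_or_lt_of_le (Nat.succ_le_of_lt hi) with rfl | hlt
  · exact h
  · exact coeff_eq_zero_of_natDegree_lt (by omega)

/-- A sum of weighted squares of polynomials of degree at most `m` needs only `m + 1` of them: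
splitting off one weighted square, which carries the leading coefficient, leaves a sum of weighted
squares of polynomials of smaller degree. -/
theorem isSumOfWeightedSquares_sum (m : ℕ) {d : ℕ} (a : Fin d → F) (f : Fin d → F[X])
    (ha : ∀ i, 0 ≤ a i) (hf : ∀ i, (f i).natDegree ≤ m) :
    IsSumOfWeightedSquares (m + 1) (∑ i, C (a i) * f i ^ 2) := by
  induction m generalizing f with
  | zero =>
    have : ∑ i, C (a i) * f i ^ 2 = C (∑ i, a i * (f i).coeff 0 ^ 2) * 1 ^ 2 := by
      rw [one_pow, mul_one, map_sum]
      refine Finset.sum_congr rfl fun i _ => ?_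
      rw [C_mul, C_pow, ← eq_C_of_natDegree_eq_zero (Nat.le_zero.1 (hf i))]
    rw [this]
    exact isSumOfWeightedSquares_one
      (Finset.sum_nonneg fun i _ => mul_nonneg (ha i) (sq_nonneg _)) 1
  | succ m ih =>
    set c : Fin d → F := fun i => (f i).coeff (m + 1) with hc
    set A : F := ∑ i, a i * c i ^ 2 with hA
    have hnn : ∀ i ∈ Finset.univ, 0 ≤ a i * c i ^ 2 := fun i _ => mul_nonneg (ha i) (sq_nonneg _)
    -- if `A = 0`, all polynomials of degree `m + 1` have weight zero
    by_cases hA0 : A = 0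
    · have hi := (Finset.sum_eq_zero_iff_of_nonneg hnn).1 hA0
      have h1 : ∑ i, C (a i) * f i ^ 2 = ∑ i, C (a i) * (if a i = 0 then 0 else f i) ^ 2 := by
        refine Finset.sum_congr rfl fun i _ => ?_
        split_ifs with h
        · simp [h]
        · rfl
      rw [h1]
      refine (ih (fun i => if a i = 0 then 0 else f i) fun i => ?_).mono (by omega)
      split_ifs with h
      · simp
      · refine natDegree_le_of_coeff_succ_eq_zero (hf i) ?_
        have := (mul_eq_zero.1 (hi i (Finset.mem_univ i))).resolve_left h
        exact pow_eq_zero_iff two_ne_zero |>.1 this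
    -- otherwise `p`, normalized to have leading coefficient one at degree `m + 1`, is chosen so that
    -- the mixed terms in the sum of `C (a i) * (f i - C (c i) * p) ^ 2` give back `A * p ^ 2`
    · set B : F[X] := ∑ i, C (a i * c i) * f i with hB
      set p : F[X] := C A⁻¹ * B with hp
      have hpc : p.coeff (m + 1) = 1 := by
        rw [hp, coeff_C_mul, hB, finsetSum_coeff, inv_mul_eq_one₀ hA0, hA]
        refine Finset.sum_congr rfl fun i _ => ?_
        rw [coeff_C_mul, sq, mul_assoc]
      have hpd : p.natDegree ≤ m + 1 := (natDegree_C_mul_le _ _).trans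
        (natDegree_sum_le_of_forall_le _ _ fun i _ => (natDegree_C_mul_le _ _).trans (hf i))
      have hBp : B = C A * p := by
        rw [hp, ← mul_assoc, ← C_mul, mul_inv_cancel₀ hA0, C_1, one_mul]
      have h1 : ∑ i, C (a i) * f i ^ 2
          = ∑ i, C (a i) * (f i - C (c i) * p) ^ 2 + C A * p ^ 2 := by
        have h2 : ∀ i, C (a i) * (f i - C (c i) * p) ^ 2
            = C (a i) * f i ^ 2 - 2 * p * (C (a i * c i) * f i) + p ^ 2 * C (a i * c i ^ 2) :=
          fun i => by simp only [C_mul, C_pow]; ring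
        simp only [h2, Finset.sum_add_distrib, Finset.sum_sub_distrib, ← Finset.mul_sum, ← hB,
          ← map_sum, ← hA]
        rw [hBp]
        ring
      rw [h1]
      refine (ih (fun i => f i - C (c i) * p) fun i => ?_).add
        (isSumOfWeightedSquares_one (Finset.sum_nonneg hnn) p)
      refine natDegree_le_of_coeff_succ_eq_zero ?_ ?_
      · exact (natDegree_sub_le_of_le (hf i) ((natDegree_C_mul_le _ _).trans hpd)).trans
          (max_self _).le
      · rw [coeff_sub, coeff_C_mul, hpc, mul_one, hc, sub_self]

theorem isSumOfWeightedSquares_of_mem {m : ℕ} {σ : F[X]} (hσ : σ ∈ weightedSquares F m) :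
    IsSumOfWeightedSquares (m + 1) σ := by
  obtain ⟨d, a, f, ha, hf, rfl⟩ : ∃ (d : ℕ) (a : Fin d → F) (f : Fin d → F[X]), (∀ i, 0 ≤ a i) ∧
      (∀ i, (f i).natDegree ≤ m) ∧ σ = ∑ i, C (a i) * f i ^ 2 := by
    induction hσ using AddSubmonoid.closure_induction with
    | zero => exact ⟨0, 0, 0, by simp, by simp, by simp⟩
    | add x y _ _ hx hy =>
      obtain ⟨d, a, f, ha, hf, rfl⟩ := hx
      obtain ⟨d', b, g, hb, hg, rfl⟩ := hy
      refine ⟨d + d', Fin.append a b, Fin.append f g, fun i => ?_, fun i => ?_, ?_⟩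
      · refine Fin.addCases (fun i => ?_) (fun i => ?_) i
        · simpa using ha i
        · simpa using hb i
      · refine Fin.addCases (fun i => ?_) (fun i => ?_) i
        · simpa using hf i
        · simpa using hg i
      · simp [Fin.sum_univ_add]
    | mem x hx =>
      obtain ⟨b, p, hb, hp, rfl⟩ := hx
      exact ⟨1, fun _ => b, fun _ => p, fun _ => hb, fun _ => hp, by simp⟩
  exact isSumOfWeightedSquares_sum m a f ha hf

theorem IsSumOfWeightedSquares.eval_nonneg {d : ℕ} {σ : F[X]} (hσ : IsSumOfWeightedSquares d σ)
    (x : ℝ) : 0 ≤ aeval x σ := by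
  obtain ⟨a, f, ha, rfl⟩ := hσ
  rw [map_sum]
  refine Finset.sum_nonneg fun i _ => ?_
  rw [map_mul, map_pow, aeval_C]
  exact mul_nonneg (ha i) (sq_nonneg _)

end IsSumOfWeightedSquares

/-! ### Domination of polynomials on a closed set -/

theorem eventually_abs_eval_le {p q : ℝ[X]} {c : ℝ} (hq : q.eval c ≠ 0) :
    ∃ N, ∀ᶠ x in nhds c, |p.eval x| ≤ N * |q.eval x| := by
  have h1 : ContinuousAt (fun x => |p.eval x| / |q.eval x|) c :=
    p.continuous.continuousAt.abs.div q.continuous.continuousAt.abs (abs_ne_zero.2 hq)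
  refine ⟨|p.eval c| / |q.eval c| + 1, ?_⟩
  filter_upwards [h1.eventually (gt_mem_nhds (lt_add_one _)),
    q.continuous.continuousAt.eventually_ne hq] with x hx hqx
  exact ((div_lt_iff₀ (abs_pos.2 hqx)).1 hx).le

theorem exists_abs_eval_le_of_ge {p q : ℝ[X]} (h : p.degree ≤ q.degree) :
    ∃ N R, ∀ x, R ≤ x → |p.eval x| ≤ N * |q.eval x| := by
  obtain ⟨N, hN⟩ := (isBigO_atTop_of_degree_le p q h).bound
  obtain ⟨R, hR⟩ := Filter.eventually_atTop.1 hN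
  exact ⟨N, R, fun x hx => by simpa using hR x hx⟩

/-- A polynomial `f ≥ 0` on a closed set `K` dominates on `K` every polynomial of no larger degree
that vanishes at the zeros of `f` in `K`, if each of these zeros is simple or isolated in `K`. -/
theorem exists_abs_eval_le_mul {K : Set ℝ} (hK : IsClosed K) {f v : ℝ[X]}
    (hf : ∀ x ∈ K, 0 ≤ f.eval x) (hdeg : v.degree ≤ f.degree)
    (hzero : ∀ c ∈ K, f.eval c = 0 →
      v.eval c = 0 ∧ (f.derivative.eval c ≠ 0 ∨ c ∉ closure (K \ {c}))) :
    ∃ N, ∀ x ∈ K, |v.eval x| ≤ N * f.eval x := by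
  obtain ⟨N₁, R₁, h₁⟩ := exists_abs_eval_le_of_ge hdeg
  have hdeg' : (v.comp (-X)).degree ≤ (f.comp (-X)).degree := by
    rwa [degree_comp_neg_X, degree_comp_neg_X]
  obtain ⟨N₂, R₂, h₂⟩ := exists_abs_eval_le_of_ge hdeg'
  have hloc : ∀ c ∈ K, ∃ N, ∀ᶠ x in nhdsWithin c (K ∩ Set.Icc (-R₂) R₁),
      x ∈ K → |v.eval x| ≤ N * f.eval x := by
    intro c hc
    suffices h : ∃ N, ∀ᶠ x in nhds c, x ∈ K → |v.eval x| ≤ N * |f.eval x| by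
      obtain ⟨N, hN⟩ := h
      refine ⟨N, nhdsWithin_le_nhds (hN.mono fun x hx hxK => ?_)⟩
      simpa [abs_of_nonneg (hf x hxK)] using hx hxK
    by_cases hfc : f.eval c = 0
    · obtain ⟨hvc, hd | hiso⟩ := hzero c hc hfc
      · obtain ⟨q, hq⟩ := dvd_iff_isRoot.2 hfc
        obtain ⟨w, hw⟩ := dvd_iff_isRoot.2 hvc
        obtain ⟨N, hN⟩ := eventually_abs_eval_le (p := w) (q := q) (c := c) (by
          rintro h0
          exact hd (by simp [hq, h0]))
        refine ⟨N, hN.mono fun x hx _ => ?_⟩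
        rw [hq, hw, eval_mul, eval_mul, abs_mul, abs_mul]
        nlinarith [abs_nonneg (eval x (X - C c))]
      · refine ⟨0, ?_⟩
        have : ∀ᶠ x in nhds c, x ∉ K \ {c} := by
          rw [mem_closure_iff_frequently] at hiso
          exact Filter.not_frequently.1 hiso
        refine this.mono fun x hx hxK => ?_
        obtain rfl : x = c := by by_contra h; exact hx ⟨hxK, h⟩
        simp [hvc]
    · obtain ⟨N, hN⟩ := eventually_abs_eval_le (p := v) hfc
      exact ⟨N, hN.mono fun x hx _ => hx⟩
  have hcomp : IsCompact (K ∩ Set.Icc (-R₂) R₁) := isCompact_Icc.inter_left hK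
  obtain ⟨N₃, h₃⟩ : ∃ N, ∀ x ∈ K ∩ Set.Icc (-R₂) R₁, x ∈ K → |v.eval x| ≤ N * f.eval x := by
    refine hcomp.induction_on ⟨0, by simp⟩ (fun s t hst ⟨N, hN⟩ => ⟨N, fun x hx => hN x (hst hx)⟩)
      (fun s t ⟨N, hN⟩ ⟨N', hN'⟩ => ⟨max N N', fun x hx hxK => ?_⟩) fun x hx => ?_
    · rcases hx with hx | hx
      · exact (hN x hx hxK).trans (mul_le_mul_of_nonneg_right (le_max_left _ _) (hf x hxK))
      · exact (hN' x hx hxK).trans (mul_le_mul_of_nonneg_right (le_max_right _ _) (hf x hxK))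
    · obtain ⟨N, hN⟩ := hloc x hx.1
      exact ⟨_, hN, N, fun y hy => hy⟩
  refine ⟨max N₁ (max N₂ N₃), fun x hx => ?_⟩
  have hfx := hf x hx
  rcases le_total R₁ x with hR | hR
  · have := h₁ x hR
    rw [abs_of_nonneg hfx] at this
    exact this.trans (mul_le_mul_of_nonneg_right (le_max_left _ _) hfx)
  · rcases le_total x (-R₂) with hR' | hR'
    · have := h₂ (-x) (by linarith)
      simp only [eval_comp, eval_neg, eval_X, neg_neg] at this
      rw [abs_of_nonneg hfx] at this
      exact this.trans
        (mul_le_mul_of_nonneg_right ((le_max_left _ _).trans (le_max_right _ _)) hfx)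
    · exact (h₃ x ⟨hx, hR', hR⟩ hx).trans
        (mul_le_mul_of_nonneg_right ((le_max_right _ _).trans (le_max_right _ _)) hfx)

/-! ### Descent from the real numbers to the subfield -/

section descent

variable {F : Subfield ℝ} {ι : Type*} [Fintype ι]

theorem eval_map_algebraMap_coe (p : F[X]) (c : F) :
    (p.map (algebraMap F ℝ)).eval (c : ℝ) = (p.eval c : F) :=
  eval_map_apply (f := algebraMap F ℝ) c

/-- `f` is a sum of products of weighted sums of squares over `F` and products of the `g i`, and
no term has degree larger than `n`. -/
def HasBoundedRepresentation (g : ι → F[X]) (n : ℕ) (f : F[X]) : Prop :=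
  ∃ σ : Finset ι → F[X], f = ∑ e, σ e * ∏ i ∈ e, g i ∧ ∀ e, σ e = 0 ∨
    ∃ m, 2 * m + (∏ i ∈ e, g i).natDegree ≤ n ∧ σ e ∈ weightedSquares F m

/-- If all zeros of `f` in `K` lie in `F` and are simple or isolated in `K`, then a small multiple
of an order unit `v`, chosen among the polynomials that vanish at these zeros, can be subtracted
from `f` without leaving the nonnegative polynomials on `K`. The room gained allows to replace the
real coefficients in a representation of the difference by elements of `F`. -/
theorem hasBoundedRepresentation_of_simple_zeros {K : Set ℝ} (hK : IsClosed K) {g : ι → F[X]}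
    (hg0 : ∀ i, g i ≠ 0) (hgK : ∀ i, ∀ x ∈ K, 0 ≤ aeval x (g i))
    (hreal : ∀ n (f : ℝ[X]), f.natDegree ≤ n → (∀ x ∈ K, 0 ≤ f.eval x) →
      f ∈ nonnegCone (fun i => (g i).map (algebraMap F ℝ)) n)
    {f : F[X]} (hf0 : f ≠ 0) (hf : ∀ x ∈ K, 0 ≤ aeval x f)
    (hzero : ∀ c ∈ K, aeval c f = 0 →
      c ∈ F ∧ (aeval c (derivative f) ≠ 0 ∨ c ∉ closure (K \ {c}))) :
    HasBoundedRepresentation g f.natDegree f := by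
  classical
  set n := f.natDegree with hn
  let ψ : F[X] →+* ℝ[X] := mapRingHom (algebraMap F ℝ)
  have hψ : ∀ (p : F[X]) (x : ℝ), (ψ p).eval x = aeval x p := fun p x =>
    eval_map_algebraMap p x
  have hψd : ∀ p : F[X], (ψ p).natDegree = p.natDegree := fun p =>
    natDegree_map_eq_of_injective (algebraMap F ℝ).injective p
  have hψ0 : ∀ p : F[X], p ≠ 0 → ψ p ≠ 0 := fun p hp =>
    (Polynomial.map_ne_zero_iff (algebraMap F ℝ).injective).2 hp
  let P : Finset ι → F[X] := fun e => ∏ i ∈ e, g i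
  have hP0 : ∀ e, P e ≠ 0 := fun e => Finset.prod_ne_zero_iff.2 fun i _ => hg0 i
  have hψP : ∀ e, ∏ i ∈ e, (g i).map (algebraMap F ℝ) = ψ (P e) := fun e =>
    (map_prod ψ g e).symm
  have hPK : ∀ e, ∀ x ∈ K, 0 ≤ (ψ (P e)).eval x := fun e x hx => by
    rw [hψ, map_prod]
    exact Finset.prod_nonneg fun i _ => hgK i x hx
  -- the zeros of `f` in `K`, and those at which a given product of generators does not vanish
  let S : Finset F := f.roots.toFinset.filter fun c => (c : ℝ) ∈ K
  have hS : ∀ c ∈ S, (c : ℝ) ∈ K ∧ f.eval c = 0 := fun c hc => by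
    simp only [S, Finset.mem_filter, Multiset.mem_toFinset, mem_roots', IsRoot.def] at hc
    exact ⟨hc.2, hc.1.2⟩
  let T : Finset ι → Finset F := fun e => S.filter fun c => (P e).eval c ≠ 0
  let D : Finset ι → F[X] := fun e => ∏ c ∈ T e, (X - C c)
  have hD0 : ∀ e, D e ≠ 0 := fun e => Finset.prod_ne_zero_iff.2 fun c _ => X_sub_C_ne_zero c
  let Q : Finset ι → F[X] := fun e => D e ^ 2 * P e
  have hQ0 : ∀ e, Q e ≠ 0 := fun e => mul_ne_zero (pow_ne_zero _ (hD0 e)) (hP0 e)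
  have hQd : ∀ e, (Q e).natDegree = 2 * (D e).natDegree + (P e).natDegree := fun e => by
    rw [natDegree_mul (pow_ne_zero _ (hD0 e)) (hP0 e), natDegree_pow]
  have hQS : ∀ e, ∀ c ∈ S, (Q e).eval c = 0 := fun e c hc => by
    by_cases h : (P e).eval c = 0
    · simp [Q, h]
    · have : (D e).eval c = 0 := by
        rw [eval_prod]
        exact Finset.prod_eq_zero (Finset.mem_filter.2 ⟨hc, h⟩) (by simp)
      simp [Q, this]
  let m : Finset ι → ℕ := fun e => (n - (Q e).natDegree) / 2
  let U : Finset ι → F[X] := fun e =>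
    if (Q e).natDegree ≤ n then evenPowerSum F (m e) else 0
  let v : F[X] := ∑ e, U e * Q e
  have hvd : v.natDegree ≤ n := by
    refine natDegree_sum_le_of_forall_le _ _ fun e _ => ?_
    by_cases h : (Q e).natDegree ≤ n
    · have h1 := natDegree_evenPowerSum_le (k := F) (m e)
      have h2 : 2 * m e ≤ n - (Q e).natDegree := Nat.mul_div_le _ _
      simp only [U, if_pos h]
      exact natDegree_mul_le.trans (by omega)
    · simp [U, if_neg h]
  have hvS : ∀ c ∈ S, v.eval c = 0 := fun c hc => by
    rw [eval_finsetSum]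
    exact Finset.sum_eq_zero fun e _ => by rw [eval_mul, hQS e c hc, mul_zero]
  obtain ⟨N, hN⟩ := exists_abs_eval_le_mul hK (f := ψ f) (v := ψ v)
    (fun x hx => by rw [hψ]; exact hf x hx)
    (by
      rw [degree_eq_natDegree (hψ0 f hf0), hψd, ← natDegree_le_iff_degree_le, hψd]
      exact hvd)
    (fun c hc hfc => by
      rw [hψ] at hfc
      obtain ⟨hcF, h⟩ := hzero c hc hfc
      have hcS : (⟨c, hcF⟩ : F) ∈ S := by
        simp only [S, Finset.mem_filter, Multiset.mem_toFinset, mem_roots hf0, IsRoot.def]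
        refine ⟨Subtype.ext ?_, hc⟩
        rw [← eval_map_algebraMap_coe]
        simpa [hψ] using hfc
      constructor
      · have := eval_map_algebraMap_coe v ⟨c, hcF⟩
        rw [hvS _ hcS] at this
        exact this
      · rwa [show derivative (ψ f) = ψ (derivative f) from derivative_map f _, hψ])
  obtain ⟨k, hk⟩ := exists_nat_gt N
  obtain ⟨ε, hε, hεN⟩ : ∃ ε : F, 0 < ε ∧ (ε : ℝ) * N ≤ 1 := by
    refine ⟨1 / ((k : F) + 1), by positivity, ?_⟩
    push_cast
    rw [div_mul_eq_mul_div, one_mul, div_le_one (by positivity)]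
    linarith
  have hε' : (0 : ℝ) < ε := hε
  obtain ⟨σ, hσ, hσd, hσsum⟩ := exists_sum_of_mem_nonnegCone
    (hreal n (ψ (f - C ε * v)) (by
      rw [hψd]
      exact (natDegree_sub_le_of_le le_rfl ((natDegree_C_mul_le _ _).trans hvd)).trans
        (max_self _).le) (fun x hx => by
      have h1 := hN x hx
      have h2 := hf x hx
      rw [hψ, hψ] at h1
      rw [hψ, map_sub, map_mul, aeval_C, sub_nonneg]
      calc (ε : ℝ) * aeval x v ≤ ε * (N * aeval x f) :=
            mul_le_mul_of_nonneg_left ((le_abs_self _).trans h1) hε'.le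
        _ = (ε * N) * aeval x f := by ring
        _ ≤ aeval x f := mul_le_of_le_one_left h2 hεN))
  simp only [hψP] at hσd hσsum
  -- each term is nonnegative on `K`, so that it vanishes where the sum does
  have hσT : ∀ e, ∀ c ∈ (T e).image ((↑) : F → ℝ), (σ e).eval c = 0 := by
    intro e c hc
    obtain ⟨c, hcT, rfl⟩ := Finset.mem_image.1 hc
    obtain ⟨hcS, hcP⟩ := Finset.mem_filter.1 hcT
    have h1 : ∑ e, (σ e * ψ (P e)).eval (c : ℝ) = 0 := by
      rw [← eval_finsetSum, ← hσsum]
      refine (eval_map_algebraMap_coe _ c).trans ?_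
      rw [eval_sub, eval_mul, hvS c hcS, (hS c hcS).2]
      simp
    have h2 := (Finset.sum_eq_zero_iff_of_nonneg fun e _ => by
      rw [eval_mul]
      exact mul_nonneg (hσ e _) (hPK e _ (hS c hcS).1)).1 h1 e (Finset.mem_univ e)
    rw [eval_mul] at h2
    refine (mul_eq_zero.1 h2).resolve_right fun h3 => hcP ?_
    rw [show (ψ (P e)).eval (c : ℝ) = _ from eval_map_algebraMap_coe _ c] at h3
    exact_mod_cast h3
  choose τ hτ hστ using fun e => exists_eq_prod_sq_mul_of_nonneg (hσ e) (hσT e)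
  have hψD : ∀ e, ∏ c ∈ (T e).image ((↑) : F → ℝ), (X - C c) = ψ (D e) := fun e => by
    rw [Finset.prod_image (Subtype.val_injective.injOn), map_prod]
    exact Finset.prod_congr rfl fun c _ => by simp [ψ]; rfl
  simp only [hψD] at hστ
  have hτQ : ∀ e, σ e * ψ (P e) = τ e * ψ (Q e) := fun e => by
    rw [hστ e, map_mul, map_pow]; ring
  have hτd : ∀ e, τ e = 0 ∨ (τ e).natDegree + (Q e).natDegree ≤ n := fun e => by
    by_cases h : τ e = 0
    · exact Or.inl h
    · have := hσd e
      rw [hτQ, natDegree_mul h (hψ0 _ (hQ0 e)), hψd] at this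
      exact Or.inr this
  obtain ⟨φ, hφ1, hφ⟩ := exists_seq_linearMap_tendsto F
  obtain ⟨M, hM⟩ : ∃ M, ∀ e, (Q e).natDegree ≤ n →
      mapCoeff (φ M) (τ e) + C ε * evenPowerSum F (m e) ∈ weightedSquares F (m e) := by
    refine Filter.Eventually.exists (f := Filter.atTop) (Filter.eventually_all.2 fun e => ?_)
    by_cases h : (Q e).natDegree ≤ n
    · refine (eventually_mapCoeff_add_mem_weightedSquares hφ (mem_weightedSquares_of_nonneg (m e)
        (τ e) ?_ (hτ e)) hε).mono fun _ h _ => h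
      rcases hτd e with h0 | h1
      · simp [h0]
      · simp only [m]; omega
    · exact Filter.Eventually.of_forall fun _ h' => absurd h' h
  refine ⟨fun e => D e ^ 2 * (mapCoeff (φ M) (τ e) + C ε * U e), ?_, fun e => ?_⟩
  · have h1 : ψ f = ψ (C ε * v) + ∑ e, τ e * ψ (Q e) := by
      simp only [← hτQ]
      rw [← hσsum, map_sub]
      ring
    have h2 := congrArg (mapCoeff (φ M)) h1
    rw [mapCoeff_add, mapCoeff_sum] at h2
    have h3 : ∀ p : F[X], mapCoeff (φ M) (ψ p) = p := mapCoeff_map (hφ1 M)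
    have h4 : ∀ (q : ℝ[X]) (p : F[X]), mapCoeff (φ M) (q * ψ p) = mapCoeff (φ M) q * p :=
      mapCoeff_mul_map (φ M)
    simp only [h3, h4] at h2
    rw [h2, Finset.mul_sum, ← Finset.sum_add_distrib]
    refine Finset.sum_congr rfl fun e _ => ?_
    simp only [Q, P]
    ring
  · by_cases h : (Q e).natDegree ≤ n
    · refine Or.inr ⟨(D e).natDegree + m e, ?_, ?_⟩
      · have h1 : 2 * m e ≤ n - (Q e).natDegree := Nat.mul_div_le _ _
        have h2 := hQd e
        change 2 * ((D e).natDegree + m e) + (P e).natDegree ≤ n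
        omega
      · simp only [U, if_pos h]
        exact sq_mul_mem_weightedSquares le_rfl (hM e h)
    · left
      have h0 : τ e = 0 := (hτd e).resolve_right (by omega)
      simp [U, if_neg h, h0, mapCoeff_zero]

/-- A multiple zero `c` of `f` that is an accumulation point of `K` makes the square of its minimal
polynomial `p` over `F` a divisor of `f`. The quotient is again nonnegative on `K`: an isolated
point of `K` lies in `F`, and it is no zero of `p`, because `p` would then be linear with zero
`c`. -/
theorem exists_eq_sq_mul_of_multiple_zero {K : Set ℝ}
    (hF : frontier K ⊆ (F : Set ℝ)) {f : F[X]} (hf0 : f ≠ 0) (hf : ∀ x ∈ K, 0 ≤ aeval x f)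
    {c : ℝ} (hc : c ∈ closure (K \ {c})) (hfc : aeval c f = 0)
    (hfc' : aeval c (derivative f) = 0) :
    ∃ p h : F[X], 0 < p.natDegree ∧ f = p ^ 2 * h ∧ ∀ x ∈ K, 0 ≤ aeval x h := by
  have hint : IsIntegral F c := IsAlgebraic.isIntegral ⟨f, hf0, hfc⟩
  set p := minpoly F c with hp
  have hirr : Irreducible p := minpoly.irreducible hint
  obtain ⟨q, hq⟩ := minpoly.dvd F c hfc
  have hqc : aeval c q = 0 := by
    rw [hq, derivative_mul, map_add, map_mul, map_mul, minpoly.aeval, zero_mul, add_zero] at hfc'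
    exact (mul_eq_zero.1 hfc').resolve_left
      (hirr.separable.aeval_derivative_ne_zero (minpoly.aeval F c))
  obtain ⟨h, hh⟩ := minpoly.dvd F c hqc
  have hfac : f = p ^ 2 * h := by rw [hq, hh]; ring
  refine ⟨p, h, minpoly.natDegree_pos hint, hfac, fun x hx => ?_⟩
  have hev : ∀ y : ℝ, aeval y f = aeval y p ^ 2 * aeval y h := fun y => by
    rw [hfac, map_mul, map_pow]
  by_cases hpx : aeval x p = 0
  · have hxacc : x ∈ closure (K \ {x}) := by
      by_contra hiso
      have hxF : x ∈ F := by
        refine hF ⟨subset_closure hx, fun hxint => hiso ?_⟩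
        have h1 : x ∈ closure (interior K ∩ {x}ᶜ) :=
          isOpen_interior.inter_closure ⟨hxint, by simp⟩
        exact closure_mono (Set.inter_subset_inter_left _ interior_subset) h1
      have hroot : p.IsRoot ⟨x, hxF⟩ := by
        refine Subtype.ext ?_
        rw [← eval_map_algebraMap_coe, eval_map_algebraMap]
        simpa using hpx
      have hdeg : p.natDegree = 1 :=
        natDegree_eq_of_degree_eq_some (degree_eq_one_of_irreducible_of_root hirr hroot)
      have h1 : p = X - C ⟨x, hxF⟩ := by
        have h2 := dvd_iff_isRoot.2 hroot
        exact eq_of_monic_of_dvd_of_natDegree_le (monic_X_sub_C _) (minpoly.monic hint) h2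
          (by rw [hdeg, natDegree_X_sub_C])
      have h3 := minpoly.aeval F c
      rw [← hp, h1, map_sub, aeval_X, aeval_C, sub_eq_zero] at h3
      have h4 : c = x := h3
      exact hiso (h4 ▸ hc)
    by_contra! hneg
    have h1 : ∀ᶠ y in nhds x, aeval y h < 0 :=
      h.continuous_aeval.continuousAt.eventually (gt_mem_nhds hneg)
    have h2 : ∀ᶠ y in nhds x, y ≠ x → aeval y p ≠ 0 := by
      have hfin : ((p.rootSet ℝ) \ {x}).Finite := (rootSet_finite p ℝ).sdiff
      filter_upwards [hfin.isClosed.isOpen_compl.mem_nhds (by simp)] with y hy hyx hpy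
      exact hy ⟨mem_rootSet.2 ⟨hirr.ne_zero, hpy⟩, hyx⟩
    obtain ⟨y, ⟨hyK, hyx⟩, hy1, hy2⟩ :=
      ((mem_closure_iff_frequently.1 hxacc).and_eventually (h1.and h2)).exists
    have h3 := hf y hyK
    rw [hev] at h3
    have h4 := sq_pos_of_ne_zero (hy2 hyx)
    nlinarith
  · have h1 := hf x hx
    rw [hev] at h1
    exact nonneg_of_mul_nonneg_right h1 (by positivity)

theorem hasBoundedRepresentation_of_nonneg_on {K : Set ℝ} (hK : IsClosed K)
    (hF : frontier K ⊆ (F : Set ℝ)) {g : ι → F[X]}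
    (hg0 : ∀ i, g i ≠ 0) (hgK : ∀ i, ∀ x ∈ K, 0 ≤ aeval x (g i))
    (hreal : ∀ n (f : ℝ[X]), f.natDegree ≤ n → (∀ x ∈ K, 0 ≤ f.eval x) →
      f ∈ nonnegCone (fun i => (g i).map (algebraMap F ℝ)) n)
    (n : ℕ) (f : F[X]) (hn : f.natDegree = n) (hf : ∀ x ∈ K, 0 ≤ aeval x f) :
    HasBoundedRepresentation g n f := by
  induction n using Nat.strong_induction_on generalizing f with
  | _ n ih =>
  by_cases hf0 : f = 0
  · exact ⟨0, by simp [hf0], fun e => Or.inl rfl⟩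
  by_cases hmult : ∃ c, c ∈ closure (K \ {c}) ∧ aeval c f = 0 ∧ aeval c (derivative f) = 0
  · obtain ⟨c, hc, hfc, hfc'⟩ := hmult
    obtain ⟨p, h, hp, hfac, hh⟩ := exists_eq_sq_mul_of_multiple_zero hF hf0 hf hc hfc hfc'
    have hh0 : h ≠ 0 := by rintro rfl; exact hf0 (by rw [hfac, mul_zero])
    have hp0 : p ≠ 0 := by rintro rfl; simp at hp
    have hdeg : n = 2 * p.natDegree + h.natDegree := by
      rw [← hn, hfac, natDegree_mul (pow_ne_zero _ hp0) hh0, natDegree_pow]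
    obtain ⟨σ, hσ, hσd⟩ := ih h.natDegree (by omega) h rfl hh
    refine ⟨fun e => p ^ 2 * σ e, ?_, fun e => ?_⟩
    · rw [hfac]
      conv_lhs => rw [hσ]
      rw [Finset.mul_sum]
      exact Finset.sum_congr rfl fun e _ => (mul_assoc _ _ _).symm
    · rcases hσd e with h0 | ⟨m, hm, hmem⟩
      · exact Or.inl (by simp [h0])
      · exact Or.inr ⟨p.natDegree + m, by omega, sq_mul_mem_weightedSquares le_rfl hmem⟩
  · push Not at hmult
    rw [← hn]
    refine hasBoundedRepresentation_of_simple_zeros hK hg0 hgK hreal hf0 hf fun c hc hfc => ?_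
    have h1 : aeval c (derivative f) ≠ 0 ∨ c ∉ closure (K \ {c}) := by
      by_cases h : c ∈ closure (K \ {c})
      · exact Or.inl (hmult c h hfc)
      · exact Or.inr h
    refine ⟨hF ⟨subset_closure hc, fun hint => ?_⟩, h1⟩
    -- a zero in the interior is a local minimum, and it is not isolated
    have h2 : c ∈ closure (K \ {c}) :=
      closure_mono (Set.inter_subset_inter_left _ interior_subset)
        (isOpen_interior.inter_closure (t := {c}ᶜ) ⟨hint, by simp⟩)
    have hmin : IsLocalMin (fun x => aeval x f) c := by
      filter_upwards [mem_interior_iff_mem_nhds.1 hint] with x hx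
      rw [hfc]
      exact hf x hx
    exact hmult c h2 hfc (hmin.hasDerivAt_eq_zero (f.hasDerivAt_aeval c))

end descent

/-! ### The natural generators -/

theorem IsClosedInterval.isClosed {J : Set ℝ} (h : IsClosedInterval J) : IsClosed J := by
  rcases h with ⟨a, b, -, rfl⟩ | ⟨a, rfl⟩ | ⟨a, rfl⟩ | rfl
  exacts [isClosed_Icc, isClosed_Ici, isClosed_Iic, isClosed_univ]

theorem IsFiniteUnionOfClosedIntervals.isClosed {K : Set ℝ}
    (h : IsFiniteUnionOfClosedIntervals K) : IsClosed K := by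
  obtain ⟨J, hJ, hI, rfl⟩ := h
  exact Set.sUnion_eq_biUnion ▸ hJ.isClosed_biUnion fun I hI' => (hI I hI').isClosed

theorem aeval_nonneg_of_mem_naturalGenerators {F : Subfield ℝ} {K : Set ℝ} {p : F[X]}
    (hp : p ∈ naturalGenerators F K) {x : ℝ} (hx : x ∈ K) : 0 ≤ aeval x p := by
  rcases hp with ⟨a, -, h, rfl⟩ | ⟨a, -, h, rfl⟩ | ⟨a, b, -, -, hab, h, rfl⟩ | ⟨-, rfl⟩
  · have h1 : ¬ x < a := fun hlt => (Set.eq_empty_iff_forall_notMem.1 h) x ⟨hlt, hx⟩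
    rw [map_sub, aeval_X, aeval_C]
    exact sub_nonneg.2 (not_lt.1 h1)
  · have h1 : ¬ a < x := fun hlt => (Set.eq_empty_iff_forall_notMem.1 h) x ⟨hlt, hx⟩
    rw [map_sub, aeval_X, aeval_C]
    exact sub_nonneg.2 (not_lt.1 h1)
  · have h1 : ¬ (a < x ∧ x < b) := fun hlt => (Set.eq_empty_iff_forall_notMem.1 h) x ⟨hlt, hx⟩
    have hab' : (a : ℝ) < b := hab
    rw [map_mul, map_sub, map_sub, aeval_X, aeval_C, aeval_C]
    change 0 ≤ (x - a) * (x - b)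
    rcases le_or_gt x a with h2 | h2
    · exact mul_nonneg_of_nonpos_of_nonpos (by linarith) (by linarith)
    · have h3 : (b : ℝ) ≤ x := by by_contra! h3; exact h1 ⟨h2, h3⟩
      exact mul_nonneg (by linarith) (by linarith)
  · simp

theorem ne_zero_of_mem_naturalGenerators {F : Subfield ℝ} {K : Set ℝ} {p : F[X]}
    (hp : p ∈ naturalGenerators F K) : p ≠ 0 := by
  rcases hp with ⟨a, -, -, rfl⟩ | ⟨a, -, -, rfl⟩ | ⟨a, b, -, -, -, -, rfl⟩ | ⟨-, rfl⟩
  · exact X_sub_C_ne_zero a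
  · rw [← neg_sub]
    exact neg_ne_zero.2 (X_sub_C_ne_zero a)
  · exact mul_ne_zero (X_sub_C_ne_zero a) (X_sub_C_ne_zero b)
  · exact one_ne_zero

/-- The images in `ℝ[X]` of the natural generators still contain the natural generators of `K`,
as the boundary of `K` lies in `F`. -/
theorem mem_nonnegCone_map_of_nonneg_on {F : Subfield ℝ} {K : Set ℝ} (hK : IsClosed K)
    (hne : K.Nonempty) (hF : frontier K ⊆ (F : Set ℝ)) {ι : Type*} {g : ι → F[X]}
    (hg : Set.range g = naturalGenerators F K) (n : ℕ) (f : ℝ[X]) (hn : f.natDegree ≤ n)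
    (hf : ∀ x ∈ K, 0 ≤ f.eval x) :
    f ∈ nonnegCone (fun i => (g i).map (algebraMap F ℝ)) n := by
  refine mem_nonnegCone_of_nonneg_on hK hne (fun a ha h => ?_) (fun a ha h => ?_)
    (fun a ha b hb hab h => ?_) n f hn hf
  · obtain ⟨i, hi⟩ : (X - C ⟨a, hF ha⟩ : F[X]) ∈ Set.range g := by
      rw [hg]; exact Or.inl ⟨_, ha, h, rfl⟩
    exact ⟨i, by simp only [hi, Polynomial.map_sub, map_X, map_C]; rfl⟩
  · obtain ⟨i, hi⟩ : (C ⟨a, hF ha⟩ - X : F[X]) ∈ Set.range g := by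
      rw [hg]; exact Or.inr (Or.inl ⟨_, ha, h, rfl⟩)
    exact ⟨i, by simp only [hi, Polynomial.map_sub, map_X, map_C]; rfl⟩
  · obtain ⟨i, hi⟩ : ((X - C ⟨a, hF ha⟩) * (X - C ⟨b, hF hb⟩) : F[X]) ∈ Set.range g := by
      rw [hg]; exact Or.inr (Or.inr (Or.inl ⟨_, _, ha, hb, hab, h, rfl⟩))
    exact ⟨i, by simp only [hi, Polynomial.map_mul, Polynomial.map_sub, map_X, map_C]; rfl⟩

theorem theorem3p1 (F : Subfield ℝ) (K : Set ℝ) (hK : IsFiniteUnionOfClosedIntervals K)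
    (hne : K.Nonempty) (hF : frontier K ⊆ (F : Set ℝ))
    (s : ℕ) (g : Fin s → F[X]) (hg : Set.range g = naturalGenerators F K) :
    Pos F K = preordering g ∧
    ∀ f ∈ Pos F K, ∃ σ : Finset (Fin s) → F[X],
      f = ∑ e, σ e * genProd g e ∧
      ∀ e, (σ e * genProd g e).degree ≤ f.degree ∧
        IsSumOfWeightedSquares (max 1 (f.natDegree - (genProd g e).natDegree)) (σ e) := by
  have hgi : ∀ i, g i ∈ naturalGenerators F K := fun i => hg ▸ Set.mem_range_self i
  have hgK : ∀ i, ∀ x ∈ K, 0 ≤ aeval x (g i) := fun i x hx =>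
    aeval_nonneg_of_mem_naturalGenerators (hgi i) hx
  have hbounded : ∀ f ∈ Pos F K, ∃ σ : Finset (Fin s) → F[X],
      f = ∑ e, σ e * genProd g e ∧
      ∀ e, (σ e * genProd g e).degree ≤ f.degree ∧
        IsSumOfWeightedSquares (max 1 (f.natDegree - (genProd g e).natDegree)) (σ e) := by
    intro f hf
    by_cases hf0 : f = 0
    · exact ⟨0, by simp [hf0], fun e => ⟨by simp, isSumOfWeightedSquares_zero _⟩⟩
    obtain ⟨σ, hσ, hσd⟩ := hasBoundedRepresentation_of_nonneg_on hK.isClosed hF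
      (fun i => ne_zero_of_mem_naturalGenerators (hgi i)) hgK
      (mem_nonnegCone_map_of_nonneg_on hK.isClosed hne hF hg) _ f rfl hf
    refine ⟨σ, hσ, fun e => ?_⟩
    rcases hσd e with h0 | ⟨m, hm, hmem⟩
    · rw [h0]
      exact ⟨by simp, isSumOfWeightedSquares_zero _⟩
    · change 2 * m + (genProd g e).natDegree ≤ f.natDegree at hm
      constructor
      · rw [degree_eq_natDegree hf0, ← natDegree_le_iff_degree_le]
        have := natDegree_le_of_mem_weightedSquares hmem
        exact natDegree_mul_le.trans (by omega)
      · -- `m + 1 ≤ max 1 (2 * m)`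
        exact (isSumOfWeightedSquares_of_mem hmem).mono (by omega)
  refine ⟨Set.Subset.antisymm (fun f hf => ?_) ?_, hbounded⟩
  · obtain ⟨σ, hσ, h⟩ := hbounded f hf
    exact ⟨σ, fun e => ⟨_, (h e).2⟩, hσ⟩
  · rintro f ⟨σ, hσ, rfl⟩ x hx
    rw [map_sum]
    refine Finset.sum_nonneg fun e _ => ?_
    obtain ⟨d, hd⟩ := hσ e
    rw [map_mul, genProd, map_prod]
    exact mul_nonneg (hd.eval_nonneg x) (Finset.prod_nonneg fun i _ => hgK i x hx)
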